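/- **Conventions.** Graphs are simple, and $d_G$ is the shortest path distance ($\infty$ between different components). $B_r(G,x)$ is the rooted ball of radius $r$ around $x$, i.e. the subgraph of $G$ induced on $\{y: d_G(x,y)\le r\}$, rooted at $x$. For $D\in\mathbb N$, a graph $G$ of bounded degree is $D$-doubling if $|B_{2s}(G,x)|\le D\,|B_s(G,x)|$ for all vertices $x$ and all integers $s\ge 1$. For a finite nonempty $L\subset V(G)$, the isoperimetric constant is $i_G(L)=|\partial L|/|L|$, where $\partial L$ is the set of vertices of $L$ that have a neighbour outside $L$. For $\lambda:V(G)\to\{0,1\}^{\mathbb N}$, $\lambda_m(x)\in\{0,1\}^{[m]}$ consists of the first $m$ coordinates of $\lambda(x)$. $CU^m_d$ is the set of rooted-labeled isomorphism classes of rooted balls of radius at most $m$ and of vertex degrees at most $d$, with vertices labeled by $\{0,1\}^{[m]}$. Let $\mathcal G$ be a family (repetitions allowed) of graphs of vertex degrees at most $d$, each with a labeling $\lambda_G:V(G)\to\{0,1\}^{\mathbb N}$. The labeling is proper if for every $r\ge1$ there is $s\ge1$ such that for all $G\in\mathcal G$ and $x,y\in V(G)$ with $0<d_G(x,y)\le r$,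 the labeled balls $B_s(G,x,(\lambda_G)_s)$ and $B_s(G,y,(\lambda_G)_s)$ are not rooted-labeled isomorphic. A function $\Theta:CU^m_d\to Q$ defines the labelings $\lambda_G^\Theta(x)=\Theta(B_m(G,x,(\lambda_G)_m))$. Write $x\equiv y$ if $d_G(x,y)\le K$ and $\lambda_G^\Theta(x)=\lambda_G^\Theta(y)$, and call the sets $\{y\in V(G): x\equiv y\}$ classes. $\Theta$ is an $(\varepsilon,K)$-local partitioning oracle for the labeled family if * for all $G\in\mathcal G$ and $x,y\in V(G)$, $\lambda_G^\Theta(x)=\lambda_G^\Theta(y)$ implies $d_G(x,y)\le K$ or $d_G(x,y)\ge 3K$ (so for $K\ge1$ the relation $\equiv$ is an equivalence relation); * $i_G(L)\le\varepsilon$ for every $G\in\mathcal G$ and every class $L\subset V(G)$. **Theorem.** Let $d,D\in\mathbb N$ and let $\mathcal G$ be a family of $D$-doubling graphs of vertex degrees at most $d$, equipped with a proper labeling $\{\lambda_G:V(G)\to\{0,1\}^{\mathbb N}\}_{G\in\mathcal G}$. Then for every $\varepsilon>0$ there exist integers $m,K\ge1$, a finite set $Q$ and an $(\varepsilon,K)$-local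 partitioning oracle $\Theta:CU^m_d\to Q$. In particular, for every $G\in\mathcal G$, $\equiv$ is an equivalence relation on $V(G)$, and its classes form a partition of $V(G)$ into finite sets of diameter at most $K$ and isoperimetric constant at most $\varepsilon$. -/

import Mathlib

/-- All vertex degrees of `G` are at most `d`. -/
def DegreeBound {V : Type*} (G : SimpleGraph V) (d : ℕ) : Prop :=
  ∀ v, (G.neighborSet v).encard ≤ d

/-- The ball `B_r(G, x)`: the vertices at shortest path distance at most `r` from `x`
(vertices in different components are at distance `⊤`). -/
def graphBall {V : Type*} (G : SimpleGraph V) (r : ℕ) (x : V) : Set V :=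
  {y | G.edist x y ≤ r}

/-- `G` is `D`-doubling: `|B_{2s}(G, x)| ≤ D |B_s(G, x)|` for all vertices `x` and all `s ≥ 1`.
(Used for graphs of bounded degree, whose balls are finite.) -/
def IsDoubling {V : Type*} (G : SimpleGraph V) (D : ℕ) : Prop :=
  ∀ (x : V) (s : ℕ), 1 ≤ s → (graphBall G (2 * s) x).ncard ≤ D * (graphBall G s x).ncard

/-- The boundary of `H`: the vertices of `H` having a neighbour outside `H`. -/
def vertexBoundary {V : Type*} (G : SimpleGraph V) (H : Set V) : Set V :=
  {x | x ∈ H ∧ ∃ y, y ∉ H ∧ G.Adj x y}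

/-- The isoperimetric constant `|∂H| / |H|` of a finite nonempty vertex set `H`. -/
noncomputable def isoperimetricConstant {V : Type*} (G : SimpleGraph V) (H : Set V) : ℝ :=
  ((vertexBoundary G H).ncard : ℝ) / (H.ncard : ℝ)

/-- Rooted-labeled isomorphism of the rooted labeled graphs `(G, x, a)` and `(H, y, b)`. -/
def RootedLabeledIso {V W L : Type*} (G : SimpleGraph V) (x : V) (a : V → L)
    (H : SimpleGraph W) (y : W) (b : W → L) : Prop :=
  ∃ e : G ≃g H, e x = y ∧ ∀ v, b (e v) = a v

/-- The projection `(φ(v))_m` of a Cantor label to its first `m` coordinates. -/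
def truncLabel {V : Type*} (φ : V → ℕ → Bool) (m : ℕ) : V → Fin m → Bool :=
  fun v i => φ v i

/-- The root of a ball, as a vertex of the ball. -/
def ballRoot {V : Type*} (G : SimpleGraph V) (r : ℕ) (x : V) : graphBall G r x :=
  ⟨x, by simp [graphBall]⟩

/-- The rooted-labeled balls `B_s(G, x, φ_s)` and `B_s(H, y, ψ_s)` (induced subgraphs on the
`s`-balls, labeled by the first `s` coordinates of the Cantor labels) are isomorphic. -/
def BallsIso {V W : Type*} (G : SimpleGraph V) (φ : V → ℕ → Bool)
    (H : SimpleGraph W) (ψ : W → ℕ → Bool) (s : ℕ) (x : V) (y : W) : Prop :=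
  RootedLabeledIso
    (G.induce (graphBall G s x)) (ballRoot G s x) (fun v => truncLabel φ s v.1)
    (H.induce (graphBall H s y)) (ballRoot H s y) (fun v => truncLabel ψ s v.1)

/-- The labelings `φ i` of the graphs `G i` form a proper Cantor labeling: for every `r` there is
one `s`, good for the whole family, such that vertices at distance in `(0, r]` have
non-isomorphic rooted labeled `s`-balls. -/
def IsProperLabeling {ι : Type*} {V : ι → Type*} (G : ∀ i, SimpleGraph (V i))
    (φ : ∀ i, V i → ℕ → Bool) : Prop :=
  ∀ r : ℕ, 1 ≤ r → ∃ s : ℕ, 1 ≤ s ∧ ∀ (i : ι) (x y : V i),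
    0 < (G i).edist x y → (G i).edist x y ≤ r → ¬ BallsIso (G i) (φ i) (G i) (φ i) s x y

/-- A concrete finite rooted graph of radius at most `m` and degree bound `d`, with vertex labels
in `{0,1}^[m]`. -/
structure CantorBallRep (d m : ℕ) where
  /-- number of vertices -/
  n : ℕ
  /-- the graph -/
  graph : SimpleGraph (Fin n)
  /-- the root -/
  root : Fin n
  /-- the labeling -/
  label : Fin n → Fin m → Bool
  degree_le : DegreeBound graph d
  radius_le : ∀ v, graph.edist root v ≤ m

instance CantorBallRep.setoid (d m : ℕ) : Setoid (CantorBallRep d m) where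
  r A B := RootedLabeledIso A.graph A.root A.label B.graph B.root B.label
  iseqv :=
    { refl := fun _ => ⟨SimpleGraph.Iso.refl, rfl, fun _ => rfl⟩
      symm := by
        rintro A B ⟨e, h, hl⟩
        exact ⟨e.symm, by simp [← h], fun v => by simp [← hl]⟩
      trans := by
        rintro A B C ⟨e, h, hl⟩ ⟨f, h', hl'⟩
        exact ⟨f.comp e, by simp [h, h'], fun v => by simp [hl, hl']⟩ }

/-- `CU^m_d`: rooted-labeled isomorphism classes of rooted balls of radius at most `m` and vertex
degree bound `d`, labeled by `{0,1}^[m]`. -/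
def CU (d m : ℕ) : Type := Quotient (CantorBallRep.setoid d m)

theorem graphBall_finite {V : Type*} {G : SimpleGraph V} {d : ℕ} (hd : DegreeBound G d)
    (m : ℕ) (x : V) : (graphBall G m x).Finite := by
  induction m with
  | zero =>
    refine (Set.finite_singleton x).subset ?_
    intro y hy
    have hy' : G.edist x y ≤ ((0 : ℕ) : ℕ∞) := hy
    rw [Nat.cast_zero, nonpos_iff_eq_zero, SimpleGraph.edist_eq_zero_iff] at hy'
    exact hy'.symm
  | succ m ih =>
    have hn : ∀ v, (G.neighborSet v).Finite := fun v =>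
      Set.finite_of_encard_le_coe (hd v)
    refine (ih.union (ih.biUnion fun v _ => hn v)).subset ?_
    intro y hy
    have hy' : G.edist x y ≤ ((m + 1 : ℕ) : ℕ∞) := hy
    obtain ⟨p, hp⟩ := G.exists_walk_of_edist_ne_top
      (ne_top_of_le_ne_top (ENat.natCast_ne_top _) hy')
    rw [← hp] at hy'
    have hlen : p.length ≤ m + 1 := by exact_mod_cast hy'
    rw [← SimpleGraph.edist_comm] at hp
    rw [← SimpleGraph.Walk.length_reverse] at hlen
    cases h : p.reverse with
    | nil => left; simp [graphBall]
    | cons hadj q =>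
      rename_i v
      right
      rw [h, SimpleGraph.Walk.length_cons] at hlen
      refine Set.mem_biUnion (x := v) ?_ hadj.symm
      have := SimpleGraph.edist_le q.reverse
      rw [SimpleGraph.Walk.length_reverse] at this
      exact this.trans (by exact_mod_cast (by omega : q.length ≤ m))

theorem edist_ballRoot_le {V : Type*} (G : SimpleGraph V) (m : ℕ) (x : V)
    (v : graphBall G m x) :
    (G.induce (graphBall G m x)).edist (ballRoot G m x) v ≤ m := by
  obtain ⟨y, hy⟩ := v
  have hy' : G.edist x y ≤ (m : ℕ∞) := hy
  obtain ⟨p, hp⟩ := G.exists_walk_of_edist_ne_top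
    (ne_top_of_le_ne_top (ENat.natCast_ne_top _) hy')
  rw [← hp] at hy'
  have hs : ∀ w ∈ p.support, w ∈ graphBall G m x := by
    classical
    intro w hw
    refine (SimpleGraph.edist_le (p.takeUntil w hw)).trans (le_trans ?_ hy')
    exact_mod_cast p.length_takeUntil_le_length hw
  have hle := SimpleGraph.edist_le (p.induce (graphBall G m x) hs)
  have hl : (p.induce (graphBall G m x) hs).length = p.length := by
    rw [← SimpleGraph.Walk.length_map (SimpleGraph.Embedding.induce _).toHom,
      SimpleGraph.Walk.map_induce]
    rfl
  rw [hl] at hle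
  exact hle.trans hy'

theorem DegreeBound.induce {V : Type*} {G : SimpleGraph V} {d : ℕ} (hd : DegreeBound G d)
    (S : Set V) : DegreeBound (G.induce S) d := by
  intro v
  refine le_trans ?_ (hd v.1)
  rw [← Subtype.val_injective.encard_image]
  refine Set.encard_le_encard ?_
  rintro _ ⟨w, hw, rfl⟩
  exact hw

theorem DegreeBound.of_iso {V W : Type*} {G : SimpleGraph V} {H : SimpleGraph W} {d : ℕ}
    (hd : DegreeBound G d) (e : H ≃g G) : DegreeBound H d := by
  intro v
  refine le_trans ?_ (hd (e v))
  rw [← e.injective.encard_image]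
  refine Set.encard_le_encard ?_
  rintro _ ⟨w, hw, rfl⟩
  exact e.map_adj_iff.2 hw

theorem edist_le_of_iso {V W : Type*} {G : SimpleGraph V} {H : SimpleGraph W}
    (e : G ≃g H) {x y : V} {m : ℕ} (h : G.edist x y ≤ m) : H.edist (e x) (e y) ≤ m := by
  obtain ⟨p, hp⟩ := G.exists_walk_of_edist_ne_top
    (ne_top_of_le_ne_top (ENat.natCast_ne_top _) h)
  rw [← hp] at h
  have := SimpleGraph.edist_le (p.map e.toHom)
  rw [SimpleGraph.Walk.length_map] at this
  exact this.trans h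

/-- An enumeration of the vertices of a ball. -/
noncomputable def ballEnum {V : Type*} {G : SimpleGraph V} {d : ℕ} (hd : DegreeBound G d)
    (m : ℕ) (x : V) : graphBall G m x ≃ Fin (Nat.card (graphBall G m x)) :=
  haveI : Finite (graphBall G m x) := graphBall_finite hd m x
  Finite.equivFin _

/-- The rooted labeled ball `B_m(G, x, φ_m)`, transported to `Fin n` along an enumeration. -/
noncomputable def ballRep {V : Type*} {G : SimpleGraph V} {d : ℕ} (hd : DegreeBound G d)
    (φ : V → ℕ → Bool) (m : ℕ) (x : V) : CantorBallRep d m where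
  n := Nat.card (graphBall G m x)
  graph := (G.induce (graphBall G m x)).comap (ballEnum hd m x).symm
  root := ballEnum hd m x (ballRoot G m x)
  label := fun v => truncLabel φ m ((ballEnum hd m x).symm v).1
  degree_le := (hd.induce _).of_iso (SimpleGraph.Iso.comap (ballEnum hd m x).symm _)
  radius_le := fun v => by
    have h := edist_le_of_iso (SimpleGraph.Iso.comap (ballEnum hd m x).symm _).symm
      (edist_ballRoot_le G m x ((ballEnum hd m x).symm v))
    change _ ≤ (m : ℕ∞) at h
    have e : (SimpleGraph.Iso.comap (ballEnum hd m x).symm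
        (G.induce (graphBall G m x))).symm ((ballEnum hd m x).symm v) = v :=
      (ballEnum hd m x).apply_symm_apply v
    rw [e] at h
    exact h

theorem ballRep_iso {V : Type*} {G : SimpleGraph V} {d : ℕ} (hd : DegreeBound G d)
    (φ : V → ℕ → Bool) (m : ℕ) (x : V) :
    RootedLabeledIso (G.induce (graphBall G m x)) (ballRoot G m x)
      (fun v => truncLabel φ m v.1)
      (ballRep hd φ m x).graph (ballRep hd φ m x).root (ballRep hd φ m x).label := by
  refine ⟨(SimpleGraph.Iso.comap (ballEnum hd m x).symm _).symm, rfl, fun v => ?_⟩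
  exact congrArg (fun w : graphBall G m x => truncLabel φ m w.1)
    ((ballEnum hd m x).symm_apply_apply v)

/-- The element of `CU^m_d` given by the ball `B_m(G, x, φ_m)`. -/
noncomputable def cantorBall {V : Type*} {G : SimpleGraph V} {d : ℕ} (hd : DegreeBound G d)
    (φ : V → ℕ → Bool) (m : ℕ) (x : V) : CU d m :=
  Quotient.mk _ (ballRep hd φ m x)

/-- The enumeration is immaterial: two balls give the same element of `CU^m_d` exactly when
they are isomorphic as rooted labeled graphs. -/
theorem cantorBall_eq_iff {V W : Type*} {G : SimpleGraph V} {H : SimpleGraph W} {d : ℕ}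
    (hG : DegreeBound G d) (hH : DegreeBound H d) (φ : V → ℕ → Bool) (ψ : W → ℕ → Bool)
    (m : ℕ) (x : V) (y : W) :
    cantorBall hG φ m x = cantorBall hH ψ m y ↔ BallsIso G φ H ψ m x y := by
  have key : cantorBall hG φ m x = cantorBall hH ψ m y ↔
      RootedLabeledIso (ballRep hG φ m x).graph (ballRep hG φ m x).root (ballRep hG φ m x).label
        (ballRep hH ψ m y).graph (ballRep hH ψ m y).root (ballRep hH ψ m y).label :=
    Quotient.eq
  rw [key]
  obtain ⟨a, ha, hal⟩ := ballRep_iso hG φ m x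
  obtain ⟨b, hb, hbl⟩ := ballRep_iso hH ψ m y
  constructor
  · rintro ⟨e, h, hl⟩
    refine ⟨(b.symm.comp e).comp a, ?_, fun v => ?_⟩
    · simp [ha, h, ← hb]
    · simp [← hal, ← hl, ← hbl]
  · rintro ⟨e, h, hl⟩
    refine ⟨(b.comp e).comp a.symm, ?_, fun v => ?_⟩
    · simp [← ha, h, ← hb]
    · simp [hbl, hl, ← hal]

/-- The labeling `λ^Θ(x) = Θ(B_m(G, x, λ_m))` computed by the oracle `Θ`. -/
noncomputable def oracleLabel {V Q : Type*} {G : SimpleGraph V} {d m : ℕ}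
    (hd : DegreeBound G d) (φ : V → ℕ → Bool) (Θ : CU d m → Q) (x : V) : Q :=
  Θ (cantorBall hd φ m x)

/-- The relation `x ≡ y`: the vertices are at distance at most `K` and receive the same output. -/
def OracleRel {V Q : Type*} {G : SimpleGraph V} {d m : ℕ}
    (hd : DegreeBound G d) (φ : V → ℕ → Bool) (Θ : CU d m → Q) (K : ℕ) (x y : V) : Prop :=
  G.edist x y ≤ K ∧ oracleLabel hd φ Θ x = oracleLabel hd φ Θ y

/-- The classes `{y | x ≡ y}` of the relation defined by the oracle. -/
def oracleClasses {V Q : Type*} {G : SimpleGraph V} {d m : ℕ}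
    (hd : DegreeBound G d) (φ : V → ℕ → Bool) (Θ : CU d m → Q) (K : ℕ) : Set (Set V) :=
  Set.range fun x => {y | OracleRel hd φ Θ K x y}

/-- `Θ` is an `(ε, K)`-local partitioning oracle for the labeled family. -/
structure IsLocalPartitioningOracle {ι : Type*} {V : ι → Type*} {G : ∀ i, SimpleGraph (V i)}
    {Q : Type*} {d m : ℕ} (hd : ∀ i, DegreeBound (G i) d) (φ : ∀ i, V i → ℕ → Bool)
    (ε : ℝ) (K : ℕ) (Θ : CU d m → Q) : Prop where
  near_or_far : ∀ (i : ι) (x y : V i),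
    oracleLabel (hd i) (φ i) Θ x = oracleLabel (hd i) (φ i) Θ y →
      (G i).edist x y ≤ K ∨ ((3 * K : ℕ) : ℕ∞) ≤ (G i).edist x y
  isoperimetric_le : ∀ (i : ι), ∀ L ∈ oracleClasses (hd i) (φ i) Θ K,
    isoperimetricConstant (G i) L ≤ ε

/-!
The classes are built by carving balls, and the construction is arranged so that every step can be
read off from a labeled ball of bounded radius.

Fix a large scale `n` and a `2n`-separated, `2n`-dense set of centres. By the pigeonhole principle
each centre `z` has a radius between `2n` and `4n` for which the set of endpoints of edges leaving
the ball is `n` times smaller than the `4n`-ball (`exists_small_shell`). Removing these balls one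
after another cuts the graph into cells. By the doubling property only boundedly many centres are
relevant near any vertex (`IsDoubling.card_separated_le`), so the total boundary of the cells in a
region of size comparable to `n` is `O(1 / n)` times the volume of the region. A single cell may
still be too small for its boundary. But boundedly many cells cover each `2n`-ball, so near every
centre there is a big cell, occupying a fixed proportion of its ball (`exists_big_center`). Each
small cell is attached to a big cell nearby. A cluster obtained in this way contains a big cell,
and its boundary is contained in the boundaries of the cells around it, so its isoperimetric
constant is at most `D ^ 18 / n` (`exists_cluster_map`).

All choices are broken by a colouring of the vertices by the types of their labeled balls. There
are finitely many types (`finite_CU`), and properness of the labeling makes the colouring injective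
on balls of radius proportional to `n`, so a colour names a centre unambiguously: the centres are
chosen greedily colour by colour, balls are removed in the order of the colours of their centres,
and small cells go to the big centre of least colour. The oracle outputs the colour of the big
centre of the cluster. That this is a function of a labeled ball follows from closure properties of
local functions (`IsLocal`), all of which rest on `BallsIso.exists_bijOn`: an isomorphism of balls
of radius `m + r` induces isomorphisms of the `m`-balls around the points at distance at most `r`.
-/

/-! ### Isomorphic balls look alike from nearby vertices -/

theorem edist_le_trans {V : Type*} {G : SimpleGraph V} {x y z : V} {a b k : ℕ}
    (hxy : G.edist x y ≤ a) (hyz : G.edist y z ≤ b) (hk : a + b ≤ k) : G.edist x z ≤ k :=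
  SimpleGraph.edist_triangle.trans <| (add_le_add hxy hyz).trans (by exact_mod_cast hk)

theorem edist_le_of_edist_induce_le {V : Type*} {G : SimpleGraph V} {S : Set V} {q : ℕ} {a b : S}
    (h : (G.induce S).edist a b ≤ q) : G.edist (a : V) b ≤ q := by
  obtain ⟨w, hw⟩ := (G.induce S).exists_walk_of_edist_ne_top
    (ne_top_of_le_ne_top (ENat.natCast_ne_top _) h)
  rw [← hw, ← SimpleGraph.Walk.length_map (SimpleGraph.Embedding.induce _).toHom] at h
  exact (SimpleGraph.edist_le _).trans h

/-- A geodesic of length `q` starting at distance `p` from the centre stays inside every ball of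
radius at least `p + q`. -/
theorem edist_induce_graphBall_le {V : Type*} {G : SimpleGraph V} {s p q : ℕ} {x : V}
    {a b : graphBall G s x} (ha : G.edist x a ≤ p) (hpq : p + q ≤ s)
    (h : G.edist (a : V) b ≤ q) : (G.induce (graphBall G s x)).edist a b ≤ q := by
  classical
  obtain ⟨a, ha'⟩ := a
  obtain ⟨b, hb'⟩ := b
  obtain ⟨w, hw⟩ := G.exists_walk_of_edist_ne_top
    (ne_top_of_le_ne_top (ENat.natCast_ne_top _) h)
  simp only at ha h hw
  rw [← hw] at h
  have hs : ∀ v ∈ w.support, v ∈ graphBall G s x := by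
    intro v hv
    have h1 : G.edist a v ≤ q := (SimpleGraph.edist_le (w.takeUntil v hv)).trans <|
      le_trans (by exact_mod_cast w.length_takeUntil_le_length hv) h
    exact edist_le_trans ha h1 hpq
  have hle := SimpleGraph.edist_le (w.induce (graphBall G s x) hs)
  have hl : (w.induce (graphBall G s x) hs).length = w.length := by
    rw [← SimpleGraph.Walk.length_map (SimpleGraph.Embedding.induce _).toHom,
      SimpleGraph.Walk.map_induce]
    rfl
  rw [hl] at hle
  exact hle.trans h

theorem edist_iso_graphBall_le {V W : Type*} {G : SimpleGraph V} {H : SimpleGraph W}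
    {s p q : ℕ} {x : V} {T : Set W} (e : G.induce (graphBall G s x) ≃g H.induce T)
    {a b : graphBall G s x} (ha : G.edist x a ≤ p) (hpq : p + q ≤ s)
    (hab : G.edist (a : V) b ≤ q) : H.edist (e a : W) (e b) ≤ q :=
  edist_le_of_edist_induce_le (edist_le_of_iso e (edist_induce_graphBall_le ha hpq hab))

theorem edist_root_iso_graphBall_le {V W : Type*} {G : SimpleGraph V} {H : SimpleGraph W}
    {s q : ℕ} {x : V} {y : W} (e : G.induce (graphBall G s x) ≃g H.induce (graphBall H s y))
    (he : e (ballRoot G s x) = ballRoot H s y) {b : graphBall G s x} (hq : q ≤ s)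
    (hb : G.edist x b ≤ q) : H.edist y (e b) ≤ q := by
  have h := edist_iso_graphBall_le (p := 0) (q := q) e (a := ballRoot G s x) (b := b)
    (by simp [ballRoot]) (by omega) hb
  rwa [he] at h

/-- An isomorphism of rooted labeled balls of radius `m + r` restricts to isomorphisms of the
`m`-balls around all vertices of the `r`-ball. -/
theorem BallsIso.exists_bijOn {V W : Type*} {G : SimpleGraph V} {φ : V → ℕ → Bool}
    {H : SimpleGraph W} {ψ : W → ℕ → Bool} {m r : ℕ} {x : V} {y : W}
    (h : BallsIso G φ H ψ (m + r) x y) :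
    ∃ f : V → W, Set.BijOn f (graphBall G r x) (graphBall H r y) ∧
      ∀ z ∈ graphBall G r x, H.edist y (f z) = G.edist x z ∧ BallsIso G φ H ψ m z (f z) := by
  classical
  obtain ⟨e, he, hl⟩ := h
  have he' : e.symm (ballRoot H (m + r) y) = ballRoot G (m + r) x := by simp [← he]
  have hsub : ∀ {z}, z ∈ graphBall G r x → z ∈ graphBall G (m + r) x := fun {z} hz =>
    le_trans (show G.edist x z ≤ r from hz) (by exact_mod_cast Nat.le_add_left r m)
  have hsub' : ∀ {z}, z ∈ graphBall H r y → z ∈ graphBall H (m + r) y := fun {z} hz =>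
    le_trans (show H.edist y z ≤ r from hz) (by exact_mod_cast Nat.le_add_left r m)
  have hball : ∀ z : graphBall G (m + r) x, (z : V) ∈ graphBall G r x →
      (e z : W) ∈ graphBall H r y := fun z hz =>
    edist_root_iso_graphBall_le e he (Nat.le_add_left r m) hz
  have hball' : ∀ z : graphBall H (m + r) y, (z : W) ∈ graphBall H r y →
      (e.symm z : V) ∈ graphBall G r x := fun z hz =>
    edist_root_iso_graphBall_le e.symm he' (Nat.le_add_left r m) hz
  let f : V → W := fun z => if hz : z ∈ graphBall G (m + r) x then e ⟨z, hz⟩ else y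
  have hf : ∀ z (hz : z ∈ graphBall G (m + r) x), f z = e ⟨z, hz⟩ := fun z hz => dif_pos hz
  refine ⟨f, ⟨fun z hz => ?_, fun z hz w hw hzw => ?_, fun w hw => ?_⟩, fun z hz => ⟨?_, ?_⟩⟩
  · rw [hf z (hsub hz)]
    exact hball _ hz
  · rw [hf z (hsub hz), hf w (hsub hw)] at hzw
    exact congrArg Subtype.val (e.injective (Subtype.ext hzw))
  · refine ⟨e.symm ⟨w, hsub' hw⟩, hball' _ hw, ?_⟩
    rw [hf _ (e.symm ⟨w, hsub' hw⟩).2]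
    simp
  · rw [hf z (hsub hz)]
    have hz2 := hball ⟨z, hsub hz⟩ hz
    apply le_antisymm
    · obtain ⟨k, hk⟩ := ENat.ne_top_iff_exists.1
        (ne_top_of_le_ne_top (ENat.natCast_ne_top _) (show G.edist x z ≤ r from hz))
      have hkr : (k : ℕ∞) ≤ r := hk ▸ hz
      have hkr : k ≤ r := by exact_mod_cast hkr
      rw [← hk]
      exact edist_root_iso_graphBall_le e he (by omega) hk.ge
    · obtain ⟨k, hk⟩ := ENat.ne_top_iff_exists.1
        (ne_top_of_le_ne_top (ENat.natCast_ne_top _) (show H.edist y _ ≤ r from hz2))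
      have hkr : (k : ℕ∞) ≤ r := hk ▸ hz2
      have hkr : k ≤ r := by exact_mod_cast hkr
      rw [← hk]
      have := edist_root_iso_graphBall_le (b := e ⟨z, hsub hz⟩) e.symm he'
        (show k ≤ m + r by omega) hk.ge
      simpa using this
  · have hfz := hf z (hsub hz)
    rw [hfz]
    have hz2 := hball ⟨z, hsub hz⟩ hz
    have hin : ∀ {w}, w ∈ graphBall G m z → w ∈ graphBall G (m + r) x := fun {w} hw =>
      edist_le_trans (show G.edist x z ≤ r from hz) hw (by omega)
    have hin' : ∀ {w}, w ∈ graphBall H m (e ⟨z, hsub hz⟩ : W) → w ∈ graphBall H (m + r) y :=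
      fun {w} hw => edist_le_trans (show H.edist y _ ≤ r from hz2) hw (by omega)
    refine ⟨⟨⟨fun w => ⟨e ⟨w, hin w.2⟩, ?_⟩, fun w => ⟨e.symm ⟨w, hin' w.2⟩, ?_⟩,
      fun w => ?_, fun w => ?_⟩, ?_⟩, ?_, fun w => ?_⟩
    · exact edist_iso_graphBall_le e (a := ⟨z, hsub hz⟩) (b := ⟨w, hin w.2⟩) hz (by omega) w.2
    · have := edist_iso_graphBall_le e.symm (a := e ⟨z, hsub hz⟩) (b := ⟨w, hin' w.2⟩) hz2
        (by omega) w.2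
      rwa [e.symm_apply_apply] at this
    · simp
    · simp
    · intro a b
      exact e.map_rel_iff (a := ⟨a, hin a.2⟩) (b := ⟨b, hin b.2⟩)
    · rfl
    · funext k
      exact congrFun (hl ⟨w, hin w.2⟩) ⟨k, by omega⟩

/-! ### Local functions on a family of labeled graphs -/

/-- A function on the vertices of all members of a family of labeled graphs is local if, for
some `m`, its value at a vertex depends only on the isomorphism class of the rooted labeled
`m`-ball of the vertex, uniformly over the family. -/
def IsLocal {ι : Type*} {V : ι → Type*} (G : ∀ i, SimpleGraph (V i)) (φ : ∀ i, V i → ℕ → Bool)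
    {α : Type*} (F : ∀ i, V i → α) : Prop :=
  ∃ m, ∀ i j x y, BallsIso (G i) (φ i) (G j) (φ j) m x y → F i x = F j y

theorem BallsIso.mono {V W : Type*} {G : SimpleGraph V} {φ : V → ℕ → Bool}
    {H : SimpleGraph W} {ψ : W → ℕ → Bool} {m m' : ℕ} {x : V} {y : W}
    (h : BallsIso G φ H ψ m' x y) (hm : m ≤ m') : BallsIso G φ H ψ m x y := by
  obtain ⟨r, rfl⟩ := Nat.exists_eq_add_of_le hm
  obtain ⟨f, -, hf⟩ := h.exists_bijOn
  obtain ⟨h1, h2⟩ := hf x (by simp [graphBall])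
  rw [SimpleGraph.edist_self, SimpleGraph.edist_eq_zero_iff] at h1
  rwa [← h1] at h2

namespace IsLocal

variable {ι : Type*} {V : ι → Type*} {G : ∀ i, SimpleGraph (V i)} {φ : ∀ i, V i → ℕ → Bool}
  {α β : Type*} {F : ∀ i, V i → α}

theorem const (a : α) : IsLocal G φ fun _ _ => a := ⟨0, fun _ _ _ _ _ => rfl⟩

theorem comp (h : IsLocal G φ F) (g : α → β) : IsLocal G φ fun i x => g (F i x) := by
  obtain ⟨m, hm⟩ := h
  exact ⟨m, fun i j x y hxy => congrArg g (hm i j x y hxy)⟩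

theorem prodMk (h : IsLocal G φ F) {F' : ∀ i, V i → β} (h' : IsLocal G φ F') :
    IsLocal G φ fun i x => (F i x, F' i x) := by
  obtain ⟨m, hm⟩ := h
  obtain ⟨m', hm'⟩ := h'
  exact ⟨max m m', fun i j x y hxy => Prod.ext (hm i j x y (hxy.mono (le_max_left _ _)))
    (hm' i j x y (hxy.mono (le_max_right _ _)))⟩

/-- It is a local matter how many vertices `z` at distance at most `r` have a given property that
is expressed in terms of the value of a local function at `z` and of the distance of `z`. -/
theorem count (h : IsLocal G φ F) (r : ℕ) :
    IsLocal G φ fun i x (P : α → ℕ∞ → Prop) =>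
      {z | (G i).edist x z ≤ r ∧ P (F i z) ((G i).edist x z)}.ncard := by
  obtain ⟨m, hm⟩ := h
  refine ⟨m + r, fun i j x y hxy => funext fun P => ?_⟩
  obtain ⟨f, hf, hfz⟩ := hxy.exists_bijOn
  refine Set.BijOn.ncard_eq (f := f) ⟨fun z hz => ?_, hf.injOn.mono fun z hz => hz.1,
    fun w hw => ?_⟩
  · obtain ⟨h1, h2⟩ := hfz z hz.1
    refine ⟨hf.mapsTo hz.1, ?_⟩
    rw [h1, ← hm _ _ _ _ h2]
    exact hz.2
  · obtain ⟨z, hz, rfl⟩ := hf.surjOn hw.1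
    obtain ⟨h1, h2⟩ := hfz z hz
    refine ⟨z, ⟨hz, ?_⟩, rfl⟩
    rw [← h1, hm _ _ _ _ h2]
    exact hw.2

/-- It is a local matter whether some vertex `z` at distance at most `r` has a given property that
is expressed in terms of the value of a local function at `z` and of the distance of `z`. -/
theorem exists_near (h : IsLocal G φ F) (r : ℕ) :
    IsLocal G φ fun i x (P : α → ℕ∞ → Prop) =>
      ∃ z, (G i).edist x z ≤ r ∧ P (F i z) ((G i).edist x z) := by
  obtain ⟨m, hm⟩ := h
  refine ⟨m + r, fun i j x y hxy => funext fun P => propext ?_⟩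
  obtain ⟨f, hf, hfz⟩ := hxy.exists_bijOn
  constructor
  · rintro ⟨z, hz, hP⟩
    obtain ⟨h1, h2⟩ := hfz z hz
    refine ⟨f z, hf.mapsTo hz, ?_⟩
    rw [h1, ← hm _ _ _ _ h2]
    exact hP
  · rintro ⟨w, hw, hP⟩
    obtain ⟨z, hz, rfl⟩ := hf.surjOn hw
    obtain ⟨h1, h2⟩ := hfz z hz
    refine ⟨z, hz, ?_⟩
    rw [← h1, hm _ _ _ _ h2]
    exact hP

theorem congr (h : IsLocal G φ F) {F' : ∀ i, V i → α} (h' : ∀ i x, F' i x = F i x) :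
    IsLocal G φ F' := by
  rwa [show F' = F from funext fun i => funext (h' i)]

end IsLocal

theorem isLocal_cantorBall {ι : Type*} {V : ι → Type*} {G : ∀ i, SimpleGraph (V i)} {d : ℕ}
    (hd : ∀ i, DegreeBound (G i) d) (φ : ∀ i, V i → ℕ → Bool) (m : ℕ) :
    IsLocal G φ fun i x => cantorBall (hd i) (φ i) m x :=
  ⟨m, fun i j x y h => (cantorBall_eq_iff (hd i) (hd j) (φ i) (φ j) m x y).2 h⟩

/-! ### There are finitely many isomorphism types of balls -/

theorem ncard_graphBall_le {V : Type*} {G : SimpleGraph V} {d : ℕ} (hd : DegreeBound G d)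
    (m : ℕ) (x : V) : (graphBall G m x).ncard ≤ (d + 1) ^ m := by
  classical
  have hn : ∀ v, (G.neighborSet v).Finite := fun v => Set.finite_of_encard_le_coe (hd v)
  have hc : ∀ v, (insert v (G.neighborSet v)).ncard ≤ d + 1 := fun v => by
    refine (Set.ncard_insert_le _ _).trans (Nat.add_le_add_right ?_ 1)
    have := hd v
    rw [← (hn v).cast_ncard_eq] at this
    exact_mod_cast this
  induction m with
  | zero =>
    have : graphBall G 0 x ⊆ {x} := fun y hy => by
      have hy' : G.edist x y ≤ ((0 : ℕ) : ℕ∞) := hy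
      rw [Nat.cast_zero, nonpos_iff_eq_zero, SimpleGraph.edist_eq_zero_iff] at hy'
      exact hy'.symm
    simpa using Set.ncard_le_ncard this
  | succ m ih =>
    have hfin := graphBall_finite hd m x
    have hsub : graphBall G (m + 1) x ⊆
        ⋃ v ∈ hfin.toFinset, insert v (G.neighborSet v) := by
      intro y hy
      have hy' : G.edist x y ≤ ((m + 1 : ℕ) : ℕ∞) := hy
      rw [SimpleGraph.edist_comm] at hy'
      obtain ⟨p, hp⟩ := G.exists_walk_of_edist_ne_top
        (ne_top_of_le_ne_top (ENat.natCast_ne_top _) hy')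
      rw [← hp] at hy'
      have hlen : p.length ≤ m + 1 := by exact_mod_cast hy'
      cases p with
      | nil => exact Set.mem_biUnion (x := x) (by simp [graphBall]) (Set.mem_insert _ _)
      | @cons _ v _ hadj q =>
        rw [SimpleGraph.Walk.length_cons] at hlen
        refine Set.mem_biUnion (x := v) ?_ (Set.mem_insert_of_mem _ hadj.symm)
        have := SimpleGraph.edist_le q.reverse
        rw [SimpleGraph.Walk.length_reverse] at this
        simpa [graphBall] using this.trans (by exact_mod_cast (by omega : q.length ≤ m))
    have hfin2 : (⋃ v ∈ hfin.toFinset, insert v (G.neighborSet v)).Finite :=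
      Set.Finite.biUnion (Finset.finite_toSet _) fun v _ => (hn v).insert v
    calc (graphBall G (m + 1) x).ncard
        ≤ (⋃ v ∈ hfin.toFinset, insert v (G.neighborSet v)).ncard := Set.ncard_le_ncard hsub hfin2
      _ ≤ ∑ v ∈ hfin.toFinset, (insert v (G.neighborSet v)).ncard :=
          Finset.set_ncard_biUnion_le _ _
      _ ≤ hfin.toFinset.card * (d + 1) := Finset.sum_le_card_nsmul _ _ _ fun v _ => hc v
      _ ≤ (d + 1) ^ m * (d + 1) := by
          rw [← Set.ncard_eq_toFinset_card _ hfin]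
          exact Nat.mul_le_mul_right _ ih
      _ = (d + 1) ^ (m + 1) := (pow_succ _ _).symm

theorem finite_cantorBallRep (d m : ℕ) : Finite (CantorBallRep d m) := by
  let g : CantorBallRep d m → Σ n : ℕ, SimpleGraph (Fin n) × Fin n × (Fin n → Fin m → Bool) :=
    fun A => ⟨A.n, A.graph, A.root, A.label⟩
  have hg : Function.Injective g := by
    rintro ⟨n, G, r, l, _, _⟩ ⟨n', G', r', l', _, _⟩ h
    simp only [g, Sigma.mk.injEq] at h
    obtain ⟨rfl, h⟩ := h
    simp only [heq_eq_eq, Prod.mk.injEq] at h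
    obtain ⟨rfl, rfl, rfl⟩ := h
    rfl
  have hfin : (Set.range g).Finite := by
    refine (Set.Finite.biUnion (t := fun n => Set.range (Sigma.mk n))
      (Set.finite_Iic ((d + 1) ^ m)) fun n _ => Set.finite_range _).subset ?_
    rintro _ ⟨A, rfl⟩
    refine Set.mem_biUnion (x := A.n) ?_ ⟨_, rfl⟩
    have h := ncard_graphBall_le A.degree_le m A.root
    rw [show graphBall A.graph m A.root = Set.univ from Set.eq_univ_of_forall A.radius_le,
      Set.ncard_univ, Nat.card_fin] at h
    exact h
  have := hfin.to_subtype
  exact Finite.of_injective (Set.rangeFactorization g)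
    (fun a b h => hg (congrArg Subtype.val h))

instance finite_CU (d m : ℕ) : Finite (CU d m) :=
  haveI := finite_cantorBallRep d m
  inferInstanceAs (Finite (Quotient (CantorBallRep.setoid d m)))

/-! ### Carving a doubling graph into cells with small boundary -/

theorem sum_ncard_le_of_pairwiseDisjoint {α V : Type*} (S : Finset α) (B : α → Set V) {T : Set V}
    (hT : T.Finite) (hB : ∀ a ∈ S, B a ⊆ T)
    (hdisj : ∀ a ∈ S, ∀ b ∈ S, ∀ v, v ∈ B a → v ∈ B b → a = b) :
    ∑ a ∈ S, (B a).ncard ≤ T.ncard := by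
  classical
  induction S using Finset.induction_on generalizing T with
  | empty => simp
  | insert a S ha ih =>
    rw [Finset.sum_insert ha]
    have hsub := hB a (Finset.mem_insert_self a S)
    have h := ih (T := T \ B a) (hT.subset Set.sdiff_subset)
      (fun b hb v hv => ⟨hB b (Finset.mem_insert_of_mem hb) hv, fun hva => ha <| by
        rwa [hdisj a (Finset.mem_insert_self a S) b (Finset.mem_insert_of_mem hb) v hva hv]⟩)
      (fun b hb b' hb' => hdisj b (Finset.mem_insert_of_mem hb) b' (Finset.mem_insert_of_mem hb'))
    have := Set.ncard_sdiff_add_ncard_of_subset hsub hT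
    omega

theorem IsDoubling.ncard_graphBall_le {V : Type*} {G : SimpleGraph V} {D : ℕ}
    (hD : IsDoubling G D) {s : ℕ} (hs : 1 ≤ s) (k : ℕ) (x : V) :
    (graphBall G (2 ^ k * s) x).ncard ≤ D ^ k * (graphBall G s x).ncard := by
  induction k with
  | zero => simp
  | succ k ih =>
    calc (graphBall G (2 ^ (k + 1) * s) x).ncard
        = (graphBall G (2 * (2 ^ k * s)) x).ncard := by rw [pow_succ']; ring_nf
      _ ≤ D * (graphBall G (2 ^ k * s) x).ncard := hD x _ (Nat.mul_pos (by positivity) hs)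
      _ ≤ D * (D ^ k * (graphBall G s x).ncard) := Nat.mul_le_mul_left _ ih
      _ = D ^ (k + 1) * (graphBall G s x).ncard := by ring

theorem ncard_graphBall_pos {V : Type*} {G : SimpleGraph V} {d : ℕ} (hd : DegreeBound G d)
    (s : ℕ) (x : V) : 0 < (graphBall G s x).ncard :=
  (Set.ncard_pos (graphBall_finite hd s x)).2 ⟨x, by simp [graphBall]⟩

/-- The net obtained by running through the colours `0, 1, …, k - 1` and adding, for each colour,
all vertices of that colour at distance more than `R` from everything chosen before. -/
def greedyNet {V : Type*} (G : SimpleGraph V) (c : V → ℕ) (R : ℕ) : ℕ → Set V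
  | 0 => ∅
  | k + 1 => greedyNet G c R k ∪ {x | c x = k ∧ ∀ y, G.edist x y ≤ R → y ∉ greedyNet G c R k}

/-- The two consecutive spheres of radii `r` and `r + 1` around `x`: they contain all endpoints of
edges leaving the ball of radius `r`. -/
def shell {V : Type*} (G : SimpleGraph V) (r : ℕ) (x : V) : Set V :=
  {y | G.edist x y = r ∨ G.edist x y = (r + 1 : ℕ)}

/-- A radius between `2n` and `4n - 2` whose shell is `n` times smaller than the `4n`-ball. -/
noncomputable def shellRadius {V : Type*} (G : SimpleGraph V) (n : ℕ) (x : V) : ℕ :=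
  2 * n + 2 * sInf {j | j < n ∧ n * (shell G (2 * n + 2 * j) x).ncard ≤
    (graphBall G (4 * n) x).ncard}

theorem greedyNet_separated {V : Type*} {G : SimpleGraph V} {c : V → ℕ} {R : ℕ}
    (hc : ∀ x y, G.edist x y ≤ R → c x = c y → x = y) (k : ℕ) {x y : V}
    (hx : x ∈ greedyNet G c R k) (hy : y ∈ greedyNet G c R k) (hxy : G.edist x y ≤ R) : x = y := by
  induction k with
  | zero => exact hx.elim
  | succ k ih =>
    rcases hx with hx | hx <;> rcases hy with hy | hy
    · exact ih hx hy
    · rw [SimpleGraph.edist_comm] at hxy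
      exact (hy.2 x hxy hx).elim
    · exact (hx.2 y hxy hy).elim
    · exact hc x y hxy (hx.1.trans hy.1.symm)

theorem greedyNet_mono {V : Type*} (G : SimpleGraph V) (c : V → ℕ) (R : ℕ) :
    Monotone (greedyNet G c R) :=
  monotone_nat_of_le_succ fun _ => Set.subset_union_left

theorem exists_mem_greedyNet {V : Type*} (G : SimpleGraph V) (c : V → ℕ) (R : ℕ) {k : ℕ} {x : V}
    (hx : c x < k) : ∃ y ∈ greedyNet G c R k, G.edist x y ≤ R := by
  by_cases h : ∃ y ∈ greedyNet G c R (c x), G.edist x y ≤ R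
  · obtain ⟨y, hy, hxy⟩ := h
    exact ⟨y, greedyNet_mono G c R hx.le hy, hxy⟩
  · refine ⟨x, greedyNet_mono G c R (Nat.succ_le_of_lt hx) (Or.inr ⟨rfl, fun y hxy hy => h ?_⟩),
      by simp⟩
    exact ⟨y, hy, hxy⟩

/-- By the pigeonhole principle one of the `n` disjoint shells of radii `2n, 2n + 2, …, 4n - 2` is
small. -/
theorem exists_small_shell {V : Type*} {G : SimpleGraph V} {d : ℕ} (hd : DegreeBound G d) {n : ℕ}
    (hn : 1 ≤ n) (x : V) :
    ∃ j, j < n ∧ n * (shell G (2 * n + 2 * j) x).ncard ≤ (graphBall G (4 * n) x).ncard := by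
  by_contra! h
  have hsum : ∑ j ∈ Finset.range n, (shell G (2 * n + 2 * j) x).ncard ≤
      (graphBall G (4 * n) x).ncard := by
    refine sum_ncard_le_of_pairwiseDisjoint _ _ (graphBall_finite hd _ _) ?_ ?_
    · rintro j hj y hy
      have hj := Finset.mem_range.1 hj
      rcases hy with hy | hy
      · exact hy.le.trans (by exact_mod_cast (by omega : 2 * n + 2 * j ≤ 4 * n))
      · exact hy.le.trans (by exact_mod_cast (by omega : 2 * n + 2 * j + 1 ≤ 4 * n))
    · rintro j - j' - v hv hv'
      rcases hv with hv | hv <;> rcases hv' with hv' | hv' <;>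
      · rw [hv] at hv'
        have := Nat.cast_injective hv'
        omega
  have hlt : ∑ _j ∈ Finset.range n, (graphBall G (4 * n) x).ncard <
      ∑ j ∈ Finset.range n, n * (shell G (2 * n + 2 * j) x).ncard :=
    Finset.sum_lt_sum_of_nonempty (Finset.nonempty_range_iff.2 (by omega)) fun j hj =>
      h j (Finset.mem_range.1 hj)
  rw [← Finset.mul_sum, Finset.sum_const, Finset.card_range, smul_eq_mul] at hlt
  exact absurd (Nat.mul_le_mul_left n hsum) (not_le.2 hlt)

theorem shellRadius_spec {V : Type*} {G : SimpleGraph V} {d : ℕ} (hd : DegreeBound G d) {n : ℕ}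
    (hn : 1 ≤ n) (x : V) : 2 * n ≤ shellRadius G n x ∧ shellRadius G n x + 2 ≤ 4 * n ∧
      n * (shell G (shellRadius G n x) x).ncard ≤ (graphBall G (4 * n) x).ncard := by
  obtain ⟨h1, h2⟩ := Nat.sInf_mem (exists_small_shell hd hn x)
  refine ⟨Nat.le_add_right _ _, ?_, h2⟩
  have h3 : sInf {j | j < n ∧ n * (shell G (2 * n + 2 * j) x).ncard ≤
      (graphBall G (4 * n) x).ncard} < n := h1
  unfold shellRadius
  omega

section Carving

variable {V : Type*} (G : SimpleGraph V) (N : Set V) (c r : V → ℕ) (n D : ℕ)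

/-- The carved balls `B_{r z}(z)`, `z ∈ N`, are removed in the order of the colours of their
centres: a vertex goes to the centre of least colour whose ball contains it. This is the colour of
that centre. -/
noncomputable def cellColor (y : V) : ℕ :=
  sInf {k | ∃ z, G.edist y z ≤ r z ∧ z ∈ N ∧ c z = k}

/-- The part carved out by the ball of radius `r z` around `z`. -/
def cell (z : V) : Set V :=
  {y | G.edist z y ≤ r z ∧ cellColor G N c r y = c z}

/-- A centre whose cell occupies a fixed proportion of the `2n`-ball. -/
def IsBigCenter (z : V) : Prop :=
  z ∈ N ∧ (graphBall G (2 * n) z).ncard ≤ D ^ 8 * (cell G N c r z).ncard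

open Classical in
/-- The colour of the big centre whose cell absorbs the cell of `z`: big centres keep their cells,
other cells are given to the big centre of least colour within distance `6n`. -/
noncomputable def mergeColor (z : V) : ℕ :=
  if IsBigCenter G N c r n D z then c z
  else sInf {k | ∃ w, G.edist z w ≤ (6 * n : ℕ) ∧ IsBigCenter G N c r n D w ∧ c w = k}

/-- The colour of the big centre whose cell absorbs the cell of `y`. The infimum is taken over one
value, as one centre near `y` has the colour of the cell of `y`. -/
noncomputable def clusterColor (y : V) : ℕ :=
  sInf {k | ∃ z, G.edist y z ≤ r z ∧ z ∈ N ∧ c z = cellColor G N c r y ∧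
    mergeColor G N c r n D z = k}

variable {G N c r n D}

theorem exists_cell_center (hcov : ∀ y, ∃ z ∈ N, G.edist y z ≤ (2 * n : ℕ))
    (hr : ∀ z, 2 * n ≤ r z) (y : V) :
    ∃ z, G.edist y z ≤ r z ∧ z ∈ N ∧ c z = cellColor G N c r y := by
  obtain ⟨z, hz, hyz⟩ := hcov y
  exact Nat.sInf_mem (s := {k | ∃ z, G.edist y z ≤ r z ∧ z ∈ N ∧ c z = k})
    ⟨c z, z, hyz.trans (by exact_mod_cast hr z), hz, rfl⟩

theorem cellColor_le {y z : V} (hyz : G.edist y z ≤ r z) (hz : z ∈ N) :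
    cellColor G N c r y ≤ c z :=
  Nat.sInf_le ⟨z, hyz, hz, rfl⟩

/-- An edge between different cells leaves the ball of whichever of the two centres was removed
first, so its ends lie in the shell of that centre. -/
theorem exists_mem_shell (hcov : ∀ y, ∃ z ∈ N, G.edist y z ≤ (2 * n : ℕ))
    (hr : ∀ z, 2 * n ≤ r z) {y y' : V} (hadj : G.Adj y y')
    (hne : cellColor G N c r y ≠ cellColor G N c r y') : ∃ z ∈ N, y ∈ shell G (r z) z := by
  have hstep : ∀ {u v z : V} {k : ℕ}, G.Adj u v → G.edist u z ≤ k → G.edist v z ≤ (k + 1 : ℕ) :=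
    fun {u v z k} huv huz => edist_le_trans (a := 1) (by
      rw [SimpleGraph.edist_comm, SimpleGraph.edist_eq_one_iff_adj.2 huv]; rfl) huz (by omega)
  rcases lt_or_gt_of_ne hne with h | h
  · obtain ⟨z, hyz, hz, hcz⟩ := exists_cell_center (c := c) hcov hr y
    refine ⟨z, hz, Or.inl ?_⟩
    have hy'z : ¬ G.edist y' z ≤ r z := fun h' => by
      have := cellColor_le (c := c) h' hz
      omega
    obtain ⟨k, hk⟩ := ENat.ne_top_iff_exists.1 (ne_top_of_le_ne_top (ENat.natCast_ne_top _) hyz)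
    have h1 : k ≤ r z := by exact_mod_cast hk.le.trans hyz
    rw [SimpleGraph.edist_comm, ← hk]
    congr 1
    by_contra hlt
    exact hy'z ((hstep hadj hk.ge).trans (by exact_mod_cast (by omega : k + 1 ≤ r z)))
  · obtain ⟨z, hyz, hz, hcz⟩ := exists_cell_center (c := c) hcov hr y'
    refine ⟨z, hz, Or.inr ?_⟩
    have hy'z : ¬ G.edist y z ≤ r z := fun h' => by
      have := cellColor_le (c := c) h' hz
      omega
    have h1 := hstep hadj.symm hyz
    rw [SimpleGraph.edist_comm]
    refine le_antisymm h1 ?_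
    rw [Nat.cast_add, Nat.cast_one]
    exact Order.add_one_le_of_lt (not_le.1 hy'z)

/-- A `2n`-separated set has boundedly many points in a `16n`-ball of a doubling graph. -/
theorem IsDoubling.card_separated_le {d : ℕ} (hd : DegreeBound G d) (hD : IsDoubling G D)
    (hn : 1 ≤ n) (hsep : ∀ z ∈ N, ∀ w ∈ N, G.edist z w ≤ (2 * n : ℕ) → z = w) (x : V)
    (S : Finset V) (hS : ∀ z ∈ S, z ∈ N ∧ G.edist x z ≤ (16 * n : ℕ)) : S.card ≤ D ^ 6 := by
  have h1 : ∑ z ∈ S, (graphBall G n z).ncard ≤ (graphBall G (32 * n) x).ncard := by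
    refine sum_ncard_le_of_pairwiseDisjoint _ _ (graphBall_finite hd _ _) ?_ ?_
    · intro z hz y hy
      exact edist_le_trans (hS z hz).2 hy (by omega)
    · intro z hz w hw y hy hy'
      refine hsep z (hS z hz).1 w (hS w hw).1 (edist_le_trans hy (b := n) ?_ (by omega))
      rw [SimpleGraph.edist_comm]
      exact hy'
  have h2 : ∀ z ∈ S, (graphBall G (32 * n) x).ncard ≤ D ^ 6 * (graphBall G n z).ncard := by
    intro z hz
    refine le_trans (Set.ncard_le_ncard ?_ (graphBall_finite hd _ _))
      (hD.ncard_graphBall_le hn 6 z)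
    intro y hy
    have := (hS z hz).2
    rw [SimpleGraph.edist_comm] at this
    exact edist_le_trans this hy (by omega)
  have h3 := Finset.card_nsmul_le_sum S _ _ h2
  rw [← Finset.mul_sum, smul_eq_mul] at h3
  exact Nat.le_of_mul_le_mul_right (h3.trans (Nat.mul_le_mul_left _ h1))
    (ncard_graphBall_pos hd _ x)

/-- Near every vertex there is a big centre: boundedly many cells cover its `2n`-ball, so one of
them covers a fixed proportion. -/
theorem exists_big_center {d : ℕ} (hd : DegreeBound G d) (hD : IsDoubling G D) (hn : 1 ≤ n)
    (hsep : ∀ z ∈ N, ∀ w ∈ N, G.edist z w ≤ (2 * n : ℕ) → z = w)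
    (hcov : ∀ y, ∃ z ∈ N, G.edist y z ≤ (2 * n : ℕ))
    (hr : ∀ z, 2 * n ≤ r z) (hr' : ∀ z, r z + 2 ≤ 4 * n) (x : V) :
    ∃ w, G.edist x w ≤ (6 * n : ℕ) ∧ IsBigCenter G N c r n D w := by
  classical
  have hfin : (N ∩ graphBall G (6 * n) x).Finite := (graphBall_finite hd _ x).inter_of_right _
  set S := hfin.toFinset with hS
  have hmem : ∀ z, z ∈ S ↔ z ∈ N ∧ G.edist x z ≤ (6 * n : ℕ) := fun z => by
    simp [hS, graphBall]
  have hcell : ∀ z, (cell G N c r z).Finite := fun z =>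
    (graphBall_finite hd (r z) z).subset fun y hy => hy.1
  have hcard : S.card ≤ D ^ 6 := hD.card_separated_le hd hn hsep x S fun z hz =>
    ⟨((hmem z).1 hz).1, ((hmem z).1 hz).2.trans (by exact_mod_cast (by omega : 6 * n ≤ 16 * n))⟩
  have hcover : (graphBall G (2 * n) x).ncard ≤ ∑ z ∈ S, (cell G N c r z).ncard := by
    refine le_trans (Set.ncard_le_ncard ?_ ?_) (Finset.set_ncard_biUnion_le S (cell G N c r))
    · intro y hy
      obtain ⟨z, hyz, hz, hcz⟩ := exists_cell_center (c := c) hcov hr y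
      refine Set.mem_biUnion (x := z) ((hmem z).2 ⟨hz, edist_le_trans hy hyz ?_⟩) ⟨?_, hcz.symm⟩
      · have := hr' z
        omega
      · rwa [SimpleGraph.edist_comm]
    · exact Set.Finite.biUnion (Finset.finite_toSet _) fun z _ => hcell z
  have hne : S.Nonempty := by
    rw [Finset.nonempty_iff_ne_empty]
    intro h
    rw [h, Finset.sum_empty] at hcover
    exact absurd hcover (not_le.2 (ncard_graphBall_pos hd _ x))
  obtain ⟨w, hw, hmax⟩ := S.exists_max_image (fun z => (cell G N c r z).ncard) hne
  obtain ⟨hwN, hxw⟩ := (hmem w).1 hw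
  refine ⟨w, hxw, hwN, ?_⟩
  calc (graphBall G (2 * n) w).ncard
      ≤ (graphBall G (2 ^ 2 * (2 * n)) x).ncard :=
        Set.ncard_le_ncard (fun y hy => edist_le_trans hxw hy (by omega)) (graphBall_finite hd _ _)
    _ ≤ D ^ 2 * (graphBall G (2 * n) x).ncard := hD.ncard_graphBall_le (by omega) 2 x
    _ ≤ D ^ 2 * (D ^ 6 * (cell G N c r w).ncard) := by
        refine Nat.mul_le_mul_left _ (hcover.trans ((Finset.sum_le_card_nsmul S _ _ hmax).trans ?_))
        exact Nat.mul_le_mul_right _ hcard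
    _ = D ^ 8 * (cell G N c r w).ncard := by ring

/-- The cluster colour of `y` is the colour of a centre `L y` within `10n` of `y`, and the fibres of
`L` have small boundary: every boundary vertex lies in the shell of one of the boundedly many
centres nearby, each shell is `n` times smaller than a ball that is comparable to the `2n`-ball of
the big centre of the fibre, and the fibre contains the cell of that big centre. -/
theorem exists_cluster_map {d : ℕ} (hd : DegreeBound G d) (hD : IsDoubling G D) (hn : 1 ≤ n)
    (hsep : ∀ z ∈ N, ∀ w ∈ N, G.edist z w ≤ (2 * n : ℕ) → z = w)
    (hcov : ∀ y, ∃ z ∈ N, G.edist y z ≤ (2 * n : ℕ))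
    (hr : ∀ z, 2 * n ≤ r z) (hr' : ∀ z, r z + 2 ≤ 4 * n)
    (hshell : ∀ z, n * (shell G (r z) z).ncard ≤ (graphBall G (4 * n) z).ncard)
    (hc : ∀ x y, G.edist x y ≤ (12 * n : ℕ) → c x = c y → x = y) :
    ∃ L : V → V, (∀ y, c (L y) = clusterColor G N c r n D y) ∧
      (∀ y, G.edist y (L y) ≤ (10 * n : ℕ)) ∧
      ∀ x, n * (vertexBoundary G {y | L y = L x}).ncard ≤ D ^ 18 * {y | L y = L x}.ncard := by
  classical
  choose cen hcen hcenN hcenc using exists_cell_center (c := c) hcov hr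
  -- Near `y` a centre is determined by its colour.
  have hcenu : ∀ y z, G.edist y z ≤ (4 * n : ℕ) → c z = cellColor G N c r y → z = cen y := by
    intro y z hz hcz
    refine hc z (cen y) (edist_le_trans ?_ (hcen y) (a := 4 * n) ?_) (hcz.trans (hcenc y).symm)
    · rwa [SimpleGraph.edist_comm]
    · have := hr' (cen y)
      omega
  have hf : ∀ z, ∃ w, G.edist z w ≤ (6 * n : ℕ) ∧ IsBigCenter G N c r n D w ∧
      c w = mergeColor G N c r n D z ∧ (IsBigCenter G N c r n D z → w = z) := by
    intro z
    by_cases hz : IsBigCenter G N c r n D z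
    · exact ⟨z, by simp, hz, by simp [mergeColor, hz], fun _ => rfl⟩
    · obtain ⟨w, hzw, hw⟩ := exists_big_center (c := c) hd hD hn hsep hcov hr hr' z
      obtain ⟨w', h1, h2, h3⟩ := Nat.sInf_mem (s := {k | ∃ w, G.edist z w ≤ (6 * n : ℕ) ∧
        IsBigCenter G N c r n D w ∧ c w = k}) ⟨c w, w, hzw, hw, rfl⟩
      exact ⟨w', h1, h2, by rw [h3, mergeColor, if_neg hz], fun h => (hz h).elim⟩
  choose f hf1 hf2 hf3 hf4 using hf
  have hL : ∀ y, G.edist y (f (cen y)) ≤ (10 * n : ℕ) := fun y =>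
    edist_le_trans (hcen y) (hf1 (cen y)) (by have := hr' (cen y); omega)
  refine ⟨fun y => f (cen y), fun y => ?_, hL, fun x => ?_⟩
  · obtain ⟨z, h1, -, h3, h4⟩ := Nat.sInf_mem (s := {k | ∃ z, G.edist y z ≤ r z ∧ z ∈ N ∧
      c z = cellColor G N c r y ∧ mergeColor G N c r n D z = k})
      ⟨_, cen y, hcen y, hcenN y, hcenc y, rfl⟩
    rw [hf3, ← hcenu y z (h1.trans (by have := hr' z; exact_mod_cast (by omega : r z ≤ 4 * n))) h3,
      h4]
    rfl
  · set w := f (cen x) with hw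
    set T : Set V := {y | f (cen y) = w} with hT
    have hTw : ∀ y ∈ T, G.edist w y ≤ (10 * n : ℕ) := fun y hy => by
      have := hL y
      rw [show f (cen y) = w from hy] at this
      rwa [SimpleGraph.edist_comm]
    have hTfin : T.Finite := (graphBall_finite hd _ w).subset hTw
    have hfin : (N ∩ graphBall G (16 * n) w).Finite := (graphBall_finite hd _ w).inter_of_right _
    set S := hfin.toFinset with hS
    have hmem : ∀ z, z ∈ S ↔ z ∈ N ∧ G.edist w z ≤ (16 * n : ℕ) := fun z => by
      simp [hS, graphBall]
    have hball : ∀ z, shell G (r z) z ⊆ graphBall G (4 * n) z := by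
      rintro z y (hy | hy) <;> have := hr' z
      · exact hy.le.trans (by exact_mod_cast (by omega : r z ≤ 4 * n))
      · exact hy.le.trans (by exact_mod_cast (by omega : r z + 1 ≤ 4 * n))
    -- The neighbour outside the fibre has another cell centre, so the edge leaves a carved ball.
    have hbd : vertexBoundary G T ⊆ ⋃ z ∈ S, shell G (r z) z := by
      rintro y ⟨hy, y', hy', hadj⟩
      have hne : cellColor G N c r y ≠ cellColor G N c r y' := by
        intro h
        apply hy'
        have : cen y = cen y' := hcenu y' _ (edist_le_trans (a := 1)
          (by rw [SimpleGraph.edist_comm, SimpleGraph.edist_eq_one_iff_adj.2 hadj]; rfl) (hcen y)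
          (by have := hr' (cen y); omega)) ((hcenc y).trans h)
        change f (cen y') = w
        rw [← this]
        exact hy
      obtain ⟨z, hz, hyz⟩ := exists_mem_shell hcov hr hadj hne
      refine Set.mem_biUnion (x := z) ((hmem z).2 ⟨hz, ?_⟩) hyz
      refine edist_le_trans (hTw y hy) (b := 4 * n) ?_ (by omega)
      rw [SimpleGraph.edist_comm]
      exact hball z hyz
    have hbig : IsBigCenter G N c r n D w := hf2 _
    have hcellT : cell G N c r w ⊆ T := by
      intro y hy
      have : w = cen y := hcenu y w (by
        rw [SimpleGraph.edist_comm]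
        exact hy.1.trans (by have := hr' w; exact_mod_cast (by omega : r w ≤ 4 * n))) hy.2.symm
      change f (cen y) = w
      rw [← this]
      exact hf4 w hbig
    have hcard : S.card ≤ D ^ 6 := hD.card_separated_le hd hn hsep w S fun z hz => (hmem z).1 hz
    have hsh : ∀ z ∈ S, n * (shell G (r z) z).ncard ≤ (graphBall G (2 ^ 4 * (2 * n)) w).ncard :=
      fun z hz => (hshell z).trans <| Set.ncard_le_ncard
        (fun y hy => edist_le_trans ((hmem z).1 hz).2 hy (by omega)) (graphBall_finite hd _ _)
    calc n * (vertexBoundary G T).ncard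
        ≤ n * (⋃ z ∈ S, shell G (r z) z).ncard := by
          refine Nat.mul_le_mul_left _ (Set.ncard_le_ncard hbd ?_)
          exact Set.Finite.biUnion (Finset.finite_toSet _) fun z _ =>
            (graphBall_finite hd _ z).subset (hball z)
      _ ≤ n * ∑ z ∈ S, (shell G (r z) z).ncard :=
          Nat.mul_le_mul_left _ (Finset.set_ncard_biUnion_le S _)
      _ = ∑ z ∈ S, n * (shell G (r z) z).ncard := Finset.mul_sum _ _ _
      _ ≤ S.card * (graphBall G (2 ^ 4 * (2 * n)) w).ncard := Finset.sum_le_card_nsmul _ _ _ hsh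
      _ ≤ D ^ 6 * (D ^ 4 * (D ^ 8 * T.ncard)) := by
          refine Nat.mul_le_mul hcard ((hD.ncard_graphBall_le (by omega) 4 w).trans ?_)
          refine Nat.mul_le_mul_left _ (hbig.2.trans ?_)
          exact Nat.mul_le_mul_left _ (Set.ncard_le_ncard hcellT hTfin)
      _ = D ^ 18 * T.ncard := by ring

end Carving

/-! ### The carving is local -/

namespace IsLocal

variable {ι : Type*} {V : ι → Type*} {G : ∀ i, SimpleGraph (V i)} {φ : ∀ i, V i → ℕ → Bool}
  {c r : ∀ i, V i → ℕ} {N : ∀ i, Set (V i)}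

theorem greedyNet (hc : IsLocal G φ c) (R k : ℕ) :
    IsLocal G φ fun i x => x ∈ greedyNet (G i) (c i) R k := by
  induction k with
  | zero => exact const False
  | succ k ih =>
    refine ((ih.prodMk (hc.prodMk (ih.exists_near R))).comp fun p =>
      p.1 ∨ (p.2.1 = k ∧ ¬ p.2.2 fun a _ => a)).congr fun i x => propext ?_
    refine or_congr_right (and_congr_right fun _ => ?_)
    simp only [not_exists, not_and]

theorem shellRadius (n : ℕ) : IsLocal G φ fun i x => shellRadius (G i) n x := by
  refine (((const (G := G) (φ := φ) ()).count (4 * n)).comp fun κ =>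
    2 * n + 2 * sInf {j | j < n ∧
      n * κ (fun _ e => e = (2 * n + 2 * j : ℕ) ∨ e = (2 * n + 2 * j + 1 : ℕ)) ≤
        κ fun _ _ => True}).congr fun i x => ?_
  unfold _root_.shellRadius
  congr 3
  ext j
  refine and_congr_right fun hj => ?_
  have h1 : shell (G i) (2 * n + 2 * j) x = {z | (G i).edist x z ≤ (4 * n : ℕ) ∧
      ((G i).edist x z = (2 * n + 2 * j : ℕ) ∨ (G i).edist x z = (2 * n + 2 * j + 1 : ℕ))} := by
    ext z
    refine ⟨fun hz => ⟨?_, hz⟩, fun hz => hz.2⟩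
    rcases hz with hz | hz
    · exact hz.le.trans (by exact_mod_cast (by omega : 2 * n + 2 * j ≤ 4 * n))
    · exact hz.le.trans (by exact_mod_cast (by omega : 2 * n + 2 * j + 1 ≤ 4 * n))
  rw [h1]
  simp only [and_true]
  rfl

variable {m : ℕ} (hc : IsLocal G φ c) (hr : IsLocal G φ r) (hN : IsLocal G φ fun i x => x ∈ N i)
  (hrm : ∀ i x, r i x ≤ m)

include hc hr hN hrm

theorem cellColor : IsLocal G φ fun i y => cellColor (G i) (N i) (c i) (r i) y := by
  refine (((hr.prodMk (hN.prodMk hc)).exists_near m).comp fun E =>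
    sInf {k | E fun a e => e ≤ a.1 ∧ a.2.1 ∧ a.2.2 = k}).congr fun i y => ?_
  unfold _root_.cellColor
  congr 1
  ext k
  exact exists_congr fun z => (and_iff_right_of_imp fun h =>
    h.1.trans (by exact_mod_cast hrm i z)).symm

theorem isBigCenter (n D : ℕ) :
    IsLocal G φ fun i z => IsBigCenter (G i) (N i) (c i) (r i) n D z := by
  refine ((hN.prodMk (hr.prodMk (hc.prodMk (((cellColor hc hr hN hrm).count m).prodMk
    ((const (G := G) (φ := φ) ()).count (2 * n)))))).comp fun p => p.1 ∧
      p.2.2.2.2 (fun _ _ => True) ≤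
        D ^ 8 * p.2.2.2.1 fun a e => e ≤ p.2.1 ∧ a = p.2.2.1).congr fun i z => ?_
  unfold IsBigCenter
  have h1 : cell (G i) (N i) (c i) (r i) z = {y | (G i).edist z y ≤ m ∧ (G i).edist z y ≤ r i z ∧
      _root_.cellColor (G i) (N i) (c i) (r i) y = c i z} := by
    ext y
    exact (and_iff_right_of_imp fun h => h.1.trans (by exact_mod_cast hrm i z)).symm
  rw [h1]
  simp only [and_true]
  rfl

theorem mergeColor (n D : ℕ) :
    IsLocal G φ fun i z => mergeColor (G i) (N i) (c i) (r i) n D z := by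
  classical
  have hbig := isBigCenter hc hr hN hrm n D
  refine ((hbig.prodMk (hc.prodMk ((hbig.prodMk hc).exists_near (6 * n)))).comp fun p =>
    if p.1 then p.2.1 else sInf {k | p.2.2 fun a _ => a.1 ∧ a.2 = k}).congr fun i z => ?_
  unfold _root_.mergeColor
  congr 1

theorem clusterColor (n D : ℕ) :
    IsLocal G φ fun i y => clusterColor (G i) (N i) (c i) (r i) n D y := by
  refine (((cellColor hc hr hN hrm).prodMk ((hr.prodMk (hN.prodMk (hc.prodMk
    (mergeColor hc hr hN hrm n D)))).exists_near m)).comp fun p =>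
      sInf {k | p.2 fun a e => e ≤ a.1 ∧ a.2.1 ∧ a.2.2.1 = p.1 ∧ a.2.2.2 = k}).congr
        fun i y => ?_
  unfold _root_.clusterColor
  congr 1
  ext k
  exact exists_congr fun z => (and_iff_right_of_imp fun h =>
    h.1.trans (by exact_mod_cast hrm i z)).symm

end IsLocal

/-! ### The oracle -/

/-- A local function is computed from balls of some radius `m ≥ 1` by a single function on
`CU d m`. -/
theorem IsLocal.exists_oracle {ι : Type*} {V : ι → Type*} {G : ∀ i, SimpleGraph (V i)} {d : ℕ}
    (hd : ∀ i, DegreeBound (G i) d) {φ : ∀ i, V i → ℕ → Bool} {Q : Type*} [Nonempty Q]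
    {F : ∀ i, V i → Q} (hF : IsLocal G φ F) :
    ∃ (m : ℕ) (Θ : CU d m → Q), 1 ≤ m ∧ ∀ i x, oracleLabel (hd i) (φ i) Θ x = F i x := by
  classical
  obtain ⟨m, hm⟩ := hF
  -- The value on types that do not occur in the family is arbitrary.
  let Θ : CU d (m + 1) → Q := fun q =>
    if h : ∃ p : Σ i, V i, cantorBall (hd p.1) (φ p.1) (m + 1) p.2 = q
    then F h.choose.1 h.choose.2 else Classical.arbitrary Q
  refine ⟨m + 1, Θ, Nat.le_add_left 1 m, fun i x => ?_⟩
  have h : ∃ p : Σ i, V i, cantorBall (hd p.1) (φ p.1) (m + 1) p.2 =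
      cantorBall (hd i) (φ i) (m + 1) x := ⟨⟨i, x⟩, rfl⟩
  have h2 := (cantorBall_eq_iff _ _ _ _ _ _ _).1 h.choose_spec
  rw [oracleLabel, show Θ _ = F h.choose.1 h.choose.2 from dif_pos h]
  exact hm _ _ _ _ (h2.mono (Nat.le_succ m))

/-- A proper labeling yields, for every `r`, a local colouring by finitely many colours in which
distinct vertices at distance at most `r` have distinct colours. -/
theorem IsProperLabeling.exists_coloring {ι : Type*} {V : ι → Type*} {G : ∀ i, SimpleGraph (V i)}
    {d : ℕ} (hd : ∀ i, DegreeBound (G i) d) {φ : ∀ i, V i → ℕ → Bool} (hφ : IsProperLabeling G φ)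
    {r : ℕ} (hr : 1 ≤ r) :
    ∃ (k : ℕ) (c : ∀ i, V i → ℕ), IsLocal G φ c ∧ (∀ i x, c i x < k) ∧
      ∀ i x y, (G i).edist x y ≤ r → c i x = c i y → x = y := by
  obtain ⟨s, -, hs⟩ := hφ r hr
  let e := Finite.equivFin (CU d s)
  refine ⟨Nat.card (CU d s), fun i x => e (cantorBall (hd i) (φ i) s x),
    (isLocal_cantorBall hd φ s).comp fun q => (e q : ℕ), fun i x => (e _).2, fun i x y hxy h => ?_⟩
  by_contra hne
  have h' := (cantorBall_eq_iff _ _ _ _ _ _ _).1 (e.injective (Fin.ext h))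
  exact hs i x y (pos_iff_ne_zero.2 fun h0 => hne (SimpleGraph.edist_eq_zero_iff.1 h0)) hxy h'

theorem mainTheorem2 {ι : Type*} {V : ι → Type*} (d D : ℕ) (G : ∀ i, SimpleGraph (V i))
    (hd : ∀ i, DegreeBound (G i) d) (hD : ∀ i, IsDoubling (G i) D)
    (φ : ∀ i, V i → ℕ → Bool) (hφ : IsProperLabeling G φ) (ε : ℝ) (hε : 0 < ε) :
    ∃ (m K : ℕ) (Q : Type) (_ : Finite Q) (Θ : CU d m → Q), 1 ≤ m ∧ 1 ≤ K ∧
      IsLocalPartitioningOracle hd φ ε K Θ ∧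
      ∀ i, Equivalence (OracleRel (hd i) (φ i) Θ K) ∧
        Setoid.IsPartition (oracleClasses (hd i) (φ i) Θ K) ∧
        ∀ L ∈ oracleClasses (hd i) (φ i) Θ K, L.Finite ∧
          (∀ x ∈ L, ∀ y ∈ L, (G i).edist x y ≤ K) ∧
          isoperimetricConstant (G i) L ≤ ε := by
  classical
  obtain ⟨n₀, hn₀⟩ := exists_nat_gt ((D : ℝ) ^ 18 / ε)
  obtain ⟨n, hn, hnε⟩ : ∃ n : ℕ, 1 ≤ n ∧ (D : ℝ) ^ 18 ≤ ε * n := by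
    refine ⟨n₀ + 1, Nat.le_add_left 1 _, ?_⟩
    rw [div_lt_iff₀ hε] at hn₀
    push_cast
    nlinarith
  -- Cluster centres are within `10n` of the vertices they serve, so clusters have diameter at most
  -- `K = 20n`, and centres of vertices at distance at most `3K` are at distance at most `80n`.
  obtain ⟨k, c, hcl, hck, hc⟩ := hφ.exists_coloring hd (r := 80 * n) (by omega)
  have hc' : ∀ {a : ℕ} (_ : a ≤ 80 * n) (i) (x y : V i), (G i).edist x y ≤ a → c i x = c i y →
      x = y := fun {a} ha i x y hxy => hc i x y (hxy.trans (by exact_mod_cast ha))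
  have hlocal : IsLocal G φ fun i y => clusterColor (G i) (greedyNet (G i) (c i) (2 * n) k) (c i)
      (shellRadius (G i) n) n D y :=
    IsLocal.clusterColor hcl (IsLocal.shellRadius n) (IsLocal.greedyNet hcl (2 * n) k)
      (fun i x => by have := (shellRadius_spec (hd i) hn x).2.1; omega : ∀ i x, _ ≤ 4 * n) n D
  have hmap := fun i => exists_cluster_map (n := n) (hd i) (hD i) hn
    (fun z hz w hw => greedyNet_separated (hc' (by omega) i) k hz hw)
    (fun y => exists_mem_greedyNet (G i) (c i) (2 * n) (hck i y))
    (fun z => (shellRadius_spec (hd i) hn z).1) (fun z => (shellRadius_spec (hd i) hn z).2.1)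
    (fun z => (shellRadius_spec (hd i) hn z).2.2) (hc' (by omega) i)
  choose L hLc hLd hLb using hmap
  -- All cluster colours are below `k`, so nothing is lost by reducing modulo `k + 1`, which makes
  -- the set of outputs finite and nonempty even for an empty family.
  obtain ⟨m, Θ, hm, hΘ⟩ := (hlocal.comp (Fin.ofNat (k + 1))).exists_oracle hd
  have hlabel : ∀ i x, (oracleLabel (hd i) (φ i) Θ x).val = c i (L i x) := fun i x => by
    rw [hΘ, ← hLc]
    exact Nat.mod_eq_of_lt ((hck i _).trans (Nat.lt_succ_self k))
  have hLxy : ∀ i x y, oracleLabel (hd i) (φ i) Θ x = oracleLabel (hd i) (φ i) Θ y →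
      (G i).edist x y ≤ (60 * n : ℕ) → L i x = L i y := by
    intro i x y hxy hd'
    refine hc i _ _ ?_ (by rw [← hlabel, ← hlabel, hxy])
    have h1 := hLd i x
    rw [SimpleGraph.edist_comm] at h1
    exact edist_le_trans (edist_le_trans h1 hd' le_rfl) (hLd i y) (by omega)
  have hdist : ∀ i x y, L i x = L i y → (G i).edist x y ≤ (20 * n : ℕ) := by
    intro i x y hxy
    have h1 := hLd i y
    rw [SimpleGraph.edist_comm, ← hxy] at h1
    exact edist_le_trans (hLd i x) h1 (by omega)
  have hrel : ∀ i x y, OracleRel (hd i) (φ i) Θ (20 * n) x y ↔ L i x = L i y := by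
    intro i x y
    refine ⟨fun h => hLxy i x y h.2 (h.1.trans (by exact_mod_cast (by omega : 20 * n ≤ 60 * n))),
      fun h => ⟨hdist i x y h, Fin.ext ?_⟩⟩
    rw [hlabel, hlabel, h]
  have hiso : ∀ i, ∀ T ∈ oracleClasses (hd i) (φ i) Θ (20 * n),
      isoperimetricConstant (G i) T ≤ ε := by
    rintro i _ ⟨x, rfl⟩
    have hT : {y | OracleRel (hd i) (φ i) Θ (20 * n) x y} = {y | L i y = L i x} := by
      ext y
      exact (hrel i x y).trans eq_comm
    simp only [hT]
    have h := hLb i x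
    have hn' : (0 : ℝ) < n := by exact_mod_cast hn
    refine div_le_of_le_mul₀ (Nat.cast_nonneg _) hε.le (le_of_mul_le_mul_left ?_ hn')
    calc (n : ℝ) * ((vertexBoundary (G i) {y | L i y = L i x}).ncard : ℝ)
        ≤ (D : ℝ) ^ 18 * ({y | L i y = L i x}.ncard : ℝ) := by exact_mod_cast h
      _ ≤ (ε * n) * ({y | L i y = L i x}.ncard : ℝ) := by gcongr
      _ = _ := by ring
  have heq : ∀ i, Equivalence (OracleRel (hd i) (φ i) Θ (20 * n)) := fun i =>
    ⟨fun x => (hrel i x x).2 rfl, fun {x y} h => (hrel i y x).2 ((hrel i x y).1 h).symm,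
      fun {x y z} h h' => (hrel i x z).2 (((hrel i x y).1 h).trans ((hrel i y z).1 h'))⟩
  refine ⟨m, 20 * n, Fin (k + 1), inferInstance, Θ, hm, by omega, ⟨fun i x y hxy => ?_, hiso⟩,
    fun i => ⟨heq i, ?_, ?_⟩⟩
  · by_cases h : (G i).edist x y ≤ (60 * n : ℕ)
    · exact Or.inl (hdist i x y (hLxy i x y hxy h))
    · right
      rw [show 3 * (20 * n) = 60 * n by ring]
      exact (not_le.1 h).le
  · have h : oracleClasses (hd i) (φ i) Θ (20 * n) = (Setoid.mk _ (heq i)).classes := by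
      ext T
      refine exists_congr fun x => ?_
      rw [eq_comm]
      refine Eq.congr_right (Set.ext fun y => ?_)
      exact ⟨fun h => (heq i).symm h, fun h => (heq i).symm h⟩
    rw [h]
    exact Setoid.isPartition_classes _
  · rintro T hT
    refine ⟨?_, ?_, hiso i T hT⟩
    · obtain ⟨x, rfl⟩ := hT
      exact (graphBall_finite (hd i) (20 * n) x).subset fun y hy => hy.1
    · obtain ⟨x, rfl⟩ := hT
      intro y hy z hz
      exact ((heq i).trans ((heq i).symm hy) hz).1
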